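/- Let $n\ge 1$ and let $\rho$ be a positive $C^1$ function on $(0,\infty)$. For $m\ge1$ define $s_m^\rho:\mathbb{R}^m\to\mathbb{R}^m$ by $s_m^\rho(x)=\rho(|x|)\,x$ for $x\ne0$ and $s_m^\rho(0)=0$. Assume that $s_1^\rho$ is strictly increasing and that the set of $r>0$ with $(s_1^\rho)'(r)=0$ has Lebesgue measure zero. Let $\sigma$ be the inverse function of $s_1^\rho$; it has a derivative $\sigma'(t)\in(0,\infty]$ at every $t\in s_1^\rho((0,\infty))$, where $\sigma'(t)=\infty$ exactly if $(s_1^\rho)'(\sigma(t))=0$. For $N>n$ let $v_N$ be the uniform probability measure on the sphere $S_N\subset\mathbb{R}^N$ of radius $\sqrt N$ about the origin, let $P_{n,N}:S_N\to\mathbb{R}^n$ be the projection to the first $n$ coordinates, and let $P_{n,N}^\rho=s_n^\rho\circ P_{n,N}$. Define $$f_{n,N}^\rho(x)=\lim_{\varepsilon\downarrow0}\frac{v_N\big[(P_{n,N}^\rho)^{-1}(B_\varepsilon(x))\big]}{|B_\varepsilon(x)|}\ \text{ if } x\in P_{n,N}^\rho(S_N),\qquad f_{n,N}^\rho(x)=0\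 \text{ otherwise}$$ (the limit exists in $[0,\infty]$ at every $x$ with $0<|x|<s_1^\rho(\sqrt N)$ in that image; the values at the remaining points, which form a null set, do not matter), where $B_\varepsilon(x)$ is the open ball and $|\cdot|$ its Lebesgue measure, and $$f_n^\rho(x)=\begin{cases}(2\pi)^{-n/2}\exp\!\left(-\dfrac{\sigma(|x|)^2}{2}\right)\left(\dfrac{\sigma(|x|)}{|x|}\right)^{n-1}\sigma'(|x|)&\text{if }x\in s_n^\rho(\mathbb{R}^n\setminus\{0\}),\\[2mm]0&\text{otherwise.}\end{cases}$$ Then: 1. For every $N>n$, the push-forward $(P_{n,N}^\rho)_\sharp v_N$ is a probability measure that is absolutely continuous with respect to the Lebesgue measure, with density $f_{n,N}^\rho$. 2. For every $x\in\mathbb{R}^n\setminus\{0\}$, $f_{n,N}^\rho(x)\to f_n^\rho(x)$ in $[0,\infty]$ as $N\to\infty$. 3. $f_n^\rho$ is measurable and $\int_{\mathbb{R}^n}f_n^\rho\,dx=1$. 4. The measures $(P_{n,N}^\rho)_\sharp v_N$ converge weakly, as $N\to\infty$, to the probability measure $\nu_n^\rho$ with $d\nu_n^\rho/dx=f_n^\rho$.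 -/

import Mathlib

open MeasureTheory Filter Topology Set
open scoped ENNReal BoundedContinuousFunction

noncomputable section

namespace PoincareLimit

/-- Euclidean space `ℝⁿ`. -/
abbrev E (n : ℕ) : Type := EuclideanSpace ℝ (Fin n)

open Classical in
/-- The radial map `x ↦ ρ(|x|) x` for `x ≠ 0`, `0 ↦ 0`. It is `s_n^ρ` on `V = E n` and
`s_1^ρ` on `V = ℝ`. Only the values of `ρ` on `(0, ∞)` matter. -/
def s {V : Type*} [NormedAddCommGroup V] [NormedSpace ℝ V] (ρ : ℝ → ℝ) (x : V) : V :=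
  if x = 0 then 0 else ρ ‖x‖ • x

/-- Condition (C): `ρ` is a positive `C¹` function on `(0, ∞)` and `s_1^ρ` is strictly
increasing. -/
structure ConditionC (ρ : ℝ → ℝ) : Prop where
  contDiffOn : ContDiffOn ℝ 1 ρ (Ioi 0)
  pos : ∀ r, 0 < r → 0 < ρ r
  strictMono : StrictMono (s ρ : ℝ → ℝ)

/-- The uniform probability measure on the sphere of radius `√N` about the origin of `ℝᴺ`
(`N ≥ 1`), as a measure on `ℝᴺ`: the normalized surface measure of the unit sphere,
scaled by `√N`. -/
def v (N : ℕ) : Measure (E N) :=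
  (((volume : Measure (E N)).toSphere univ)⁻¹ • (volume : Measure (E N)).toSphere).map
    (fun u : Metric.sphere (0 : E N) 1 => √(N : ℝ) • (u : E N))

/-- The projection `ℝᴺ → ℝⁿ` to the first `n` coordinates, for `n ≤ N`
(missing coordinates are read as `0` if `N < n`). -/
def proj (n N : ℕ) (x : E N) : E n :=
  WithLp.toLp 2 fun i : Fin n => if h : (i : ℕ) < N then x ⟨i, h⟩ else 0

/-- The map `P_{n,N}^ρ = s_n^ρ ∘ P_{n,N}`. -/
def P (ρ : ℝ → ℝ) (n N : ℕ) (x : E N) : E n := s ρ (proj n N x)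

/-- The push-forward of the uniform measure on the sphere under `P_{n,N}^ρ`. -/
def pushforward (ρ : ℝ → ℝ) (n N : ℕ) : Measure (E n) := (v N).map (P ρ n N)

open Classical in
/-- The density `f_{n,N}^ρ` of the push-forward: the limit of the mean densities on shrinking balls
at the points of the image of the sphere, and `0` off that image. -/
def fN (ρ : ℝ → ℝ) (n N : ℕ) (x : E n) : ℝ≥0∞ :=
  if x ∈ P ρ n N '' Metric.sphere 0 √(N : ℝ) then
    limUnder (𝓝[>] (0 : ℝ)) fun ε =>
      pushforward ρ n N (Metric.ball x ε) / volume (Metric.ball x ε)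
  else 0

/-- The derivative, in `[0, ∞]`, of a nondecreasing function: the limit of the difference
quotients, where the value `∞` is allowed. -/
def extDeriv (g : ℝ → ℝ) (t : ℝ) : ℝ≥0∞ :=
  limUnder (𝓝[≠] t) fun u => ENNReal.ofReal (slope g t u)

/-- At points of differentiability, `extDeriv` is the usual derivative. -/
theorem extDeriv_eq_deriv {g : ℝ → ℝ} {t : ℝ} (h : DifferentiableAt ℝ g t) :
    extDeriv g t = ENNReal.ofReal (deriv g t) :=
  ((ENNReal.continuous_ofReal.tendsto _).comp
    (hasDerivAt_iff_tendsto_slope.1 h.hasDerivAt)).limUnder_eq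

open Classical in
/-- The limit density `f_n^ρ`, where `σ` is the inverse function of `s_1^ρ`. -/
def f (ρ σ : ℝ → ℝ) (n : ℕ) (x : E n) : ℝ≥0∞ :=
  if x ∈ s ρ '' {y : E n | y ≠ 0} then
    ENNReal.ofReal ((2 * Real.pi) ^ (-(n : ℝ) / 2) * Real.exp (-(σ ‖x‖) ^ 2 / 2)
      * (σ ‖x‖ / ‖x‖) ^ (n - 1)) * extDeriv σ ‖x‖
  else 0

/-- The limit measure `ν_n^ρ`, with density `f_n^ρ`. -/
def ν (ρ σ : ℝ → ℝ) (n : ℕ) : Measure (E n) := volume.withDensity (f ρ σ n)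

end PoincareLimit

end

/-! For N > n, the push-forward is the image under the radial map `s ρ` of the projected sphere
measure on `E n`; the limit is the image under the same map of the standard Gaussian. A radial map
preserves rays, so in polar coordinates its effect on a radial density is a one-dimensional
substitution (`map_s_withDensity`). Nullity of the critical set makes the image absolutely
continuous, even where σ' = ∞.

The same lemma computes the projected sphere measure. The sphere is the central projection of the
ball; writing ball points as (y, z) with y = |z| w turns the projection into the radial map w ↦ √N w
/ √(1 + |w|²), applied to a density proportional to (1 + |w|²)^(-N/2) (`exists_map_proj_v_eq_map`).
The result is proportional to (1 - |y|²/N)^((N-n-2)/2) on |y| < √N (`map_proj_v`). This profile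
tends to exp(-|y|²/2) and is at most exp(-|y|²/4) for N ≥ 2n + 4, so dominated convergence gives the
constants and the weak limit.

For the pointwise statement, the image density is continuous into [0, ∞] at the relevant points, so
ball averages recover it (`tendsto_withDensity_ball_div`), and the limit is taken factor by factor.
-/

noncomputable section

namespace PoincareLimit

/-! ### The radial profile and its inverse -/

section Profile

variable {V : Type*} [NormedAddCommGroup V] [NormedSpace ℝ V] {ρ σ : ℝ → ℝ}

theorem s_of_ne_zero {y : V} (hy : y ≠ 0) : s ρ y = ρ ‖y‖ • y := by simp [s, hy]

theorem s_of_pos {r : ℝ} (hr : 0 < r) : s ρ r = ρ r * r := by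
  rw [s_of_ne_zero hr.ne', Real.norm_of_nonneg hr.le, smul_eq_mul]

theorem s_smul_of_norm_eq_one {r : ℝ} (hr : 0 < r) {u : V} (hu : ‖u‖ = 1) :
    s ρ (r • u) = s ρ r • u := by
  have hu0 : u ≠ 0 := fun h => by simp [h] at hu
  rw [s_of_ne_zero (smul_ne_zero hr.ne' hu0), s_of_pos hr, norm_smul, hu,
    Real.norm_of_nonneg hr.le, mul_one, smul_smul]

theorem ConditionC.s_pos (hρ : ConditionC ρ) {r : ℝ} (hr : 0 < r) : 0 < s ρ r := by
  rw [s_of_pos hr]; exact mul_pos (hρ.pos r hr) hr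

theorem ConditionC.norm_s (hρ : ConditionC ρ) (y : V) : ‖s ρ y‖ = s ρ ‖y‖ := by
  by_cases hy : y = 0
  · simp [s, hy]
  · have := norm_pos_iff.2 hy
    rw [s_of_ne_zero hy, s_of_pos this, norm_smul, Real.norm_of_nonneg (hρ.pos _ this).le]

theorem ConditionC.contDiffOn_s (hρ : ConditionC ρ) : ContDiffOn ℝ 1 (s ρ : ℝ → ℝ) (Ioi 0) :=
  (hρ.contDiffOn.mul contDiffOn_id).congr fun _ hr => s_of_pos hr

theorem ConditionC.hasDerivAt_s (hρ : ConditionC ρ) {r : ℝ} (hr : 0 < r) :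
    HasDerivAt (s ρ : ℝ → ℝ) (deriv (s ρ) r) r :=
  ((hρ.contDiffOn_s.contDiffAt (Ioi_mem_nhds hr)).differentiableAt one_ne_zero).hasDerivAt

theorem ConditionC.continuousOn_s (hρ : ConditionC ρ) : ContinuousOn (s ρ : ℝ → ℝ) (Ioi 0) :=
  hρ.contDiffOn_s.continuousOn

theorem ConditionC.continuousOn_deriv_s (hρ : ConditionC ρ) :
    ContinuousOn (deriv (s ρ : ℝ → ℝ)) (Ioi 0) :=
  hρ.contDiffOn_s.continuousOn_deriv_of_isOpen isOpen_Ioi le_rfl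

theorem ConditionC.deriv_s_nonneg (hρ : ConditionC ρ) (r : ℝ) : 0 ≤ deriv (s ρ : ℝ → ℝ) r :=
  hρ.strictMono.monotone.deriv_nonneg

/-- The norms of the values of the radial map off the origin. -/
def radii (ρ : ℝ → ℝ) : Set ℝ := (s ρ : ℝ → ℝ) '' Ioi 0

theorem ConditionC.Ioo_subset_image (hρ : ConditionC ρ) {a b : ℝ} (ha : 0 < a) (hab : a ≤ b) :
    Ioo (s ρ a) (s ρ b) ⊆ (s ρ : ℝ → ℝ) '' Ioo a b :=
  intermediate_value_Ioo hab (hρ.continuousOn_s.mono fun _ h => ha.trans_le h.1)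

theorem ConditionC.isOpen_radii (hρ : ConditionC ρ) : IsOpen (radii ρ) := by
  rw [isOpen_iff_mem_nhds]
  rintro _ ⟨r, hr, rfl⟩
  have hr : 0 < r := hr
  filter_upwards [Ioo_mem_nhds (hρ.strictMono (half_lt_self hr)) (hρ.strictMono (lt_add_one r))]
    with u hu
  obtain ⟨w, hw, rfl⟩ := hρ.Ioo_subset_image (half_pos hr) (by linarith) hu
  exact ⟨w, (half_pos hr).trans hw.1, rfl⟩

theorem ConditionC.pos_of_mem_radii (hρ : ConditionC ρ) {t : ℝ} (ht : t ∈ radii ρ) : 0 < t := by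
  obtain ⟨r, hr, rfl⟩ := ht
  exact hρ.s_pos hr

theorem inverse_pos (hσ : Function.LeftInverse σ (s ρ : ℝ → ℝ)) {t : ℝ} (ht : t ∈ radii ρ) :
    0 < σ t := by
  obtain ⟨r, hr, rfl⟩ := ht
  rw [hσ r]; exact hr

theorem s_inverse (hσ : Function.LeftInverse σ (s ρ : ℝ → ℝ)) {t : ℝ} (ht : t ∈ radii ρ) :
    s ρ (σ t) = t := by
  obtain ⟨r, hr, rfl⟩ := ht
  rw [hσ r]

theorem ConditionC.continuousAt_inverse (hρ : ConditionC ρ)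
    (hσ : Function.LeftInverse σ (s ρ : ℝ → ℝ)) {t : ℝ} (ht : t ∈ radii ρ) :
    ContinuousAt σ t := by
  obtain ⟨r, hr, rfl⟩ := ht
  have hr : 0 < r := hr
  rw [ContinuousAt, hσ r]
  refine (nhds_basis_Ioo r).tendsto_right_iff.2 ?_
  rintro ⟨a, b⟩ ⟨ha, hb⟩
  simp only at ha hb
  -- The bound r / 2 keeps the interval inside (0, ∞): `s ρ` may jump at the origin, as for ρ(r) = 1
  -- + 1/r.
  have hm : 0 < max a (r / 2) := lt_max_of_lt_right (half_pos hr)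
  have hm' : max a (r / 2) < r := max_lt ha (half_lt_self hr)
  filter_upwards [Ioo_mem_nhds (hρ.strictMono hm') (hρ.strictMono hb)] with u hu
  obtain ⟨w, hw, rfl⟩ := hρ.Ioo_subset_image hm (hm'.trans hb).le hu
  rw [hσ w]
  exact ⟨(le_max_left _ _).trans_lt hw.1, hw.2⟩

/-- The derivative of the inverse function, in `(0, ∞]`. -/
theorem ConditionC.extDeriv_inverse (hρ : ConditionC ρ)
    (hσ : Function.LeftInverse σ (s ρ : ℝ → ℝ)) {t : ℝ} (ht : t ∈ radii ρ) :
    extDeriv σ t = (ENNReal.ofReal (deriv (s ρ : ℝ → ℝ) (σ t)))⁻¹ := by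
  refine Tendsto.limUnder_eq ?_
  -- Difference quotients of σ are reciprocals of those of `s ρ` at σ u ≠ σ t. Inversion is
  -- continuous on [0, ∞], so a zero derivative needs no separate case.
  have hlim : Tendsto σ (𝓝[≠] t) (𝓝[≠] (σ t)) := by
    refine tendsto_nhdsWithin_iff.2
      ⟨(hρ.continuousAt_inverse hσ ht).tendsto.mono_left nhdsWithin_le_nhds, ?_⟩
    filter_upwards [nhdsWithin_le_nhds (hρ.isOpen_radii.mem_nhds ht), self_mem_nhdsWithin]
      with u hu hne heq
    exact hne (by rw [mem_singleton_iff, ← s_inverse hσ hu, ← s_inverse hσ ht, heq])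
  have h1 := (hasDerivAt_iff_tendsto_slope.1 (hρ.hasDerivAt_s (inverse_pos hσ ht))).comp hlim
  refine ((continuous_inv.tendsto _).comp
    ((ENNReal.continuous_ofReal.tendsto _).comp h1)).congr' ?_
  filter_upwards [nhdsWithin_le_nhds (hρ.isOpen_radii.mem_nhds ht), self_mem_nhdsWithin]
    with u hu hne
  have hne' : σ u ≠ σ t := fun heq =>
    hne (by rw [mem_singleton_iff, ← s_inverse hσ hu, ← s_inverse hσ ht, heq])
  have hpos : 0 < slope (s ρ : ℝ → ℝ) (σ t) (σ u) := by
    rw [slope_def_field]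
    rcases hne'.lt_or_gt with hlt | hlt
    · exact div_pos_of_neg_of_neg (sub_neg.2 (hρ.strictMono hlt)) (sub_neg.2 hlt)
    · exact div_pos (sub_pos.2 (hρ.strictMono hlt)) (sub_pos.2 hlt)
  simp only [Function.comp_apply]
  rw [← ENNReal.ofReal_inv_of_pos hpos]
  simp only [slope_def_field, s_inverse hσ hu, s_inverse hσ ht, inv_div]

theorem ConditionC.continuousAt_extDeriv_inverse (hρ : ConditionC ρ)
    (hσ : Function.LeftInverse σ (s ρ : ℝ → ℝ)) {t : ℝ} (ht : t ∈ radii ρ) :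
    ContinuousAt (extDeriv σ) t := by
  have h : ContinuousAt (fun t => (ENNReal.ofReal (deriv (s ρ : ℝ → ℝ) (σ t)))⁻¹) t := by
    refine continuous_inv.continuousAt.comp
      (ENNReal.continuous_ofReal.continuousAt.comp ?_)
    exact ContinuousAt.comp (hρ.continuousOn_deriv_s.continuousAt
      (Ioi_mem_nhds (inverse_pos hσ ht))) (hρ.continuousAt_inverse hσ ht)
  refine h.congr ?_
  filter_upwards [hρ.isOpen_radii.mem_nhds ht] with u hu using (hρ.extDeriv_inverse hσ hu).symm

theorem ConditionC.mem_image_s_iff (hρ : ConditionC ρ) {x : V} :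
    x ∈ s ρ '' {y : V | y ≠ 0} ↔ ‖x‖ ∈ radii ρ := by
  constructor
  · rintro ⟨y, hy, rfl⟩
    exact ⟨‖y‖, norm_pos_iff.2 hy, (hρ.norm_s y).symm⟩
  · intro h
    have hx0 := hρ.pos_of_mem_radii h
    obtain ⟨r, hr, hrx⟩ := h
    have hu : ‖‖x‖⁻¹ • x‖ = 1 := norm_smul_inv_norm (𝕜 := ℝ) (norm_pos_iff.1 hx0)
    refine ⟨r • ‖x‖⁻¹ • x, ?_, ?_⟩
    · exact norm_ne_zero_iff.1 (by rw [norm_smul, hu, mul_one]; exact norm_ne_zero_iff.2 hr.ne')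
    · rw [s_smul_of_norm_eq_one hr hu, hrx, smul_inv_smul₀ hx0.ne']

end Profile

/-! ### Polar coordinates -/

section Polar

variable {V : Type*} [NormedAddCommGroup V] [NormedSpace ℝ V] [MeasurableSpace V] [BorelSpace V]
  [FiniteDimensional ℝ V] [Nontrivial V]

/-- Integration in polar coordinates. -/
theorem lintegral_polar (μ : Measure V) [μ.IsAddHaarMeasure] {F : V → ℝ≥0∞} (hF : Measurable F) :
    ∫⁻ x, F x ∂μ = ∫⁻ u : Metric.sphere (0 : V) 1, (∫⁻ r in Ioi (0 : ℝ),
      ENNReal.ofReal (r ^ (Module.finrank ℝ V - 1)) * F (r • (u : V))) ∂μ.toSphere := by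
  have hG : Measurable fun p : Metric.sphere (0 : V) 1 × Ioi (0 : ℝ) =>
      F ((p.2 : ℝ) • (p.1 : V)) := by
    refine hF.comp (Continuous.measurable ?_)
    fun_prop
  calc ∫⁻ x, F x ∂μ = ∫⁻ x : ({0}ᶜ : Set V), F x ∂(μ.comap (↑)) := by
        rw [lintegral_subtype_comap (measurableSet_singleton _).compl, restrict_compl_singleton]
    _ = ∫⁻ p, F ((p.2 : ℝ) • (p.1 : V))
          ∂(μ.toSphere.prod (.volumeIoiPow (Module.finrank ℝ V - 1))) := by
        rw [← μ.measurePreserving_homeomorphUnitSphereProd.lintegral_comp hG]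
        refine lintegral_congr fun x => ?_
        congr 1
        have h := congrArg (Subtype.val) ((homeomorphUnitSphereProd V).symm_apply_apply x)
        rw [homeomorphUnitSphereProd_symm_apply_coe] at h
        exact h.symm
    _ = _ := by
        rw [lintegral_prod _ hG.aemeasurable]
        refine lintegral_congr fun u => ?_
        have hGu : Measurable fun r : Ioi (0 : ℝ) => F ((r : ℝ) • (u : V)) :=
          hG.comp measurable_prodMk_left
        rw [Measure.volumeIoiPow, lintegral_withDensity_eq_lintegral_mul _ (by fun_prop) hGu]
        exact lintegral_subtype_comap measurableSet_Ioi
          (fun r : ℝ => ENNReal.ofReal (r ^ (Module.finrank ℝ V - 1)) * F (r • (u : V)))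

end Polar

/-! ### Images of radial densities under radial maps -/

section RadialPushforward

variable {V : Type*} [NormedAddCommGroup V] [NormedSpace ℝ V] {ρ σ : ℝ → ℝ}

/-- The radial profile of the density of the image, under the radial map of `ρ` with inverse
profile `σ`, of the measure with radial density `h` in dimension `d + 1`. -/
def radialDensity (ρ σ : ℝ → ℝ) (d : ℕ) (h : ℝ → ℝ≥0∞) : ℝ → ℝ≥0∞ :=
  (radii ρ).indicator fun t => h (σ t) * ENNReal.ofReal ((σ t / t) ^ d) * extDeriv σ t

theorem ConditionC.measurable_s (hρ : ConditionC ρ) [MeasurableSpace V] [BorelSpace V] :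
    Measurable (s ρ : V → V) := by
  classical
  have h : (s ρ : V → V) = ({0}ᶜ : Set V).piecewise (fun y => ρ ‖y‖ • y) 0 := by
    ext1 y
    by_cases hy : y = 0 <;> simp [s, hy]
  rw [h]
  refine ContinuousOn.measurable_piecewise ?_ continuousOn_const
    (measurableSet_singleton _).compl
  refine ContinuousOn.smul ?_ continuousOn_id
  exact hρ.contDiffOn.continuousOn.comp continuousOn_id.norm fun y hy => norm_pos_iff.2 hy

theorem ConditionC.measurable_radialDensity (hρ : ConditionC ρ)
    (hσ : Function.LeftInverse σ (s ρ : ℝ → ℝ)) (d : ℕ) {h : ℝ → ℝ≥0∞} (hh : Measurable h) :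
    Measurable (radialDensity ρ σ d h) := by
  classical
  have hO := hρ.isOpen_radii.measurableSet
  -- Nothing controls σ at positive arguments outside `radii ρ`, so it is replaced by 0 there.
  have h1 : Measurable ((radii ρ).piecewise σ 0) :=
    ContinuousOn.measurable_piecewise
      (fun t ht => (hρ.continuousAt_inverse hσ ht).continuousWithinAt) continuousOn_const hO
  have h2 : Measurable ((radii ρ).piecewise (extDeriv σ) 0) :=
    ContinuousOn.measurable_piecewise
      (fun t ht => (hρ.continuousAt_extDeriv_inverse hσ ht).continuousWithinAt)
      continuousOn_const hO
  have h3 : Measurable fun t => h ((radii ρ).piecewise σ 0 t) *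
      ENNReal.ofReal (((radii ρ).piecewise σ 0 t / t) ^ d) *
      (radii ρ).piecewise (extDeriv σ) 0 t := by
    fun_prop
  convert h3.indicator hO using 1
  ext1 t
  by_cases ht : t ∈ radii ρ <;> simp [radialDensity, ht]

/-- On each ray this is the substitution t = s(r): the factor (σ(t)/t)^d turns t^d into r^d, and
σ'(t) cancels the Jacobian s'(r). -/
theorem ConditionC.map_s_withDensity (hρ : ConditionC ρ)
    (hσ : Function.LeftInverse σ (s ρ : ℝ → ℝ))
    (hcrit : volume {r : ℝ | 0 < r ∧ deriv (s ρ : ℝ → ℝ) r = 0} = 0)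
    [MeasurableSpace V] [BorelSpace V] [FiniteDimensional ℝ V] [Nontrivial V]
    (μ : Measure V) [μ.IsAddHaarMeasure] {h : ℝ → ℝ≥0∞} (hh : Measurable h) :
    (μ.withDensity fun y => h ‖y‖).map (s ρ) =
      μ.withDensity fun x => radialDensity ρ σ (Module.finrank ℝ V - 1) h ‖x‖ := by
  have hs : Measurable (s ρ : V → V) := hρ.measurable_s
  have hD := hρ.measurable_radialDensity hσ (Module.finrank ℝ V - 1) hh
  refine Measure.ext_of_lintegral _ fun φ hφ => ?_
  have hφs : Measurable fun y : V => φ (s ρ y) := hφ.comp hs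
  rw [lintegral_map hφ hs, lintegral_withDensity_eq_lintegral_mul _ (by fun_prop) hφs,
    lintegral_withDensity_eq_lintegral_mul _ (by fun_prop) hφ,
    lintegral_polar μ (by fun_prop), lintegral_polar μ (by fun_prop)]
  refine lintegral_congr fun u => ?_
  have hu : ‖(u : V)‖ = 1 := by simp
  set d := Module.finrank ℝ V - 1
  have hnorm : ∀ {r : ℝ}, 0 < r → ‖r • (u : V)‖ = r := fun {r} hr => by
    rw [norm_smul, hu, mul_one, Real.norm_of_nonneg hr.le]
  have hsub : radii ρ ⊆ Ioi 0 := fun t ht => hρ.pos_of_mem_radii ht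
  let G : ℝ → ℝ≥0∞ := fun t => ENNReal.ofReal (t ^ d) *
    (h (σ t) * ENNReal.ofReal ((σ t / t) ^ d) * extDeriv σ t * φ (t • (u : V)))
  have hR : ∫⁻ t in Ioi (0 : ℝ), ENNReal.ofReal (t ^ d) *
      ((fun x : V => radialDensity ρ σ d h ‖x‖) * φ) (t • (u : V)) = ∫⁻ t in radii ρ, G t := by
    rw [← inter_eq_self_of_subset_left hsub, ← setLIntegral_indicator
      hρ.isOpen_radii.measurableSet]
    refine setLIntegral_congr_fun measurableSet_Ioi fun t ht => ?_
    simp only [Pi.mul_apply, hnorm ht, radialDensity, G]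
    by_cases htr : t ∈ radii ρ <;> simp [htr]
  rw [hR, radii, lintegral_image_eq_lintegral_abs_deriv_mul measurableSet_Ioi
    (fun r hr => (hρ.hasDerivAt_s hr).hasDerivWithinAt) hρ.strictMono.injective.injOn]
  -- At a critical point the product s' · σ' is 0 · ∞ = 0 rather than 1, so the cancellation holds
  -- only almost everywhere.
  have hae : ∀ᵐ r ∂(volume.restrict (Ioi (0 : ℝ))), deriv (s ρ : ℝ → ℝ) r ≠ 0 := by
    rw [ae_restrict_iff' measurableSet_Ioi, ae_iff]
    refine measure_mono_null (fun r hr => ?_) hcrit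
    simpa using hr
  refine lintegral_congr_ae ?_
  filter_upwards [hae, ae_restrict_mem measurableSet_Ioi] with r hne hr
  have hr : 0 < r := hr
  have hmem : s ρ r ∈ radii ρ := ⟨r, hr, rfl⟩
  have hspos := hρ.s_pos hr
  have hdpos : 0 < deriv (s ρ : ℝ → ℝ) r := (hρ.deriv_s_nonneg r).lt_of_ne' hne
  simp only [Pi.mul_apply, hnorm hr, G, s_smul_of_norm_eq_one hr hu,
    hρ.extDeriv_inverse hσ hmem, hσ r, abs_of_pos hdpos]
  have e1 : ENNReal.ofReal (s ρ r ^ d) * ENNReal.ofReal ((r / s ρ r) ^ d)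
      = ENNReal.ofReal (r ^ d) := by
    rw [← ENNReal.ofReal_mul (by positivity), ← mul_pow, mul_div_cancel₀ _ hspos.ne']
  have e2 : ENNReal.ofReal (deriv (s ρ : ℝ → ℝ) r) *
      (ENNReal.ofReal (deriv (s ρ : ℝ → ℝ) r))⁻¹ = 1 :=
    ENNReal.mul_inv_cancel (by simpa using hdpos) ENNReal.ofReal_ne_top
  calc _ = (ENNReal.ofReal (s ρ r ^ d) * ENNReal.ofReal ((r / s ρ r) ^ d)) *
        (h r * φ (s ρ r • (u : V))) := by rw [e1]
    _ = (ENNReal.ofReal (s ρ r ^ d) * ENNReal.ofReal ((r / s ρ r) ^ d)) *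
        (h r * φ (s ρ r • (u : V))) * (ENNReal.ofReal (deriv (s ρ : ℝ → ℝ) r) *
      (ENNReal.ofReal (deriv (s ρ : ℝ → ℝ) r))⁻¹) := by rw [e2, mul_one]
    _ = _ := by ring

end RadialPushforward

/-! ### Ball averages of a continuous extended density -/

section Averages

/-- At a point of continuity of its density, a measure has that density as the limit of its mean
densities on shrinking balls. The density may be infinite there. -/
theorem tendsto_withDensity_ball_div {V : Type*} [PseudoMetricSpace V] [MeasurableSpace V]
    [OpensMeasurableSpace V] (μ : Measure V) [μ.IsOpenPosMeasure] {D : V → ℝ≥0∞} {x : V}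
    (hD : ContinuousAt D x) (hfin : ∀ᶠ ε in 𝓝[>] (0 : ℝ), μ (Metric.ball x ε) ≠ ∞) :
    Tendsto (fun ε => μ.withDensity D (Metric.ball x ε) / μ (Metric.ball x ε)) (𝓝[>] 0)
      (𝓝 (D x)) := by
  have key : ∀ p : V → Prop, (∀ᶠ y in 𝓝 x, p y) → ∀ᶠ ε in 𝓝[>] (0 : ℝ),
      (∀ y ∈ Metric.ball x ε, p y) ∧ μ (Metric.ball x ε) ≠ 0 ∧ μ (Metric.ball x ε) ≠ ∞ := by
    intro p hp
    obtain ⟨δ, hδ, hball⟩ := Metric.eventually_nhds_iff_ball.1 hp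
    filter_upwards [hfin, Ioo_mem_nhdsGT hδ] with ε hε hε'
    exact ⟨fun y hy => hball y (Metric.ball_subset_ball hε'.2.le hy),
      (Metric.measure_ball_pos μ x hε'.1).ne', hε⟩
  refine tendsto_order.2 ⟨fun a ha => ?_, fun b hb => ?_⟩
  -- Integration only preserves weak inequalities; the intermediate c restores strictness and stays
  -- meaningful when D x = ∞.
  · obtain ⟨c, hac, hc⟩ := exists_between ha
    filter_upwards [key _ (hD.eventually (lt_mem_nhds hc))] with ε ⟨h1, h2, h3⟩
    refine hac.trans_le ?_
    rw [ENNReal.le_div_iff_mul_le (.inl h2) (.inl h3), withDensity_apply _ measurableSet_ball,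
      ← setLIntegral_const]
    exact setLIntegral_mono' measurableSet_ball fun y hy => (h1 y hy).le
  · obtain ⟨c, hc, hcb⟩ := exists_between hb
    filter_upwards [key _ (hD.eventually (gt_mem_nhds hc))] with ε ⟨h1, h2, h3⟩
    refine lt_of_le_of_lt ?_ hcb
    rw [ENNReal.div_le_iff_le_mul (.inl h2) (.inl h3), withDensity_apply _ measurableSet_ball,
      ← setLIntegral_const]
    exact setLIntegral_mono' measurableSet_ball fun y hy => (h1 y hy).le

end Averages

/-! ### The uniform measure on the sphere and orthogonal splitting -/

section Sphere

/-- The uniform measure on the sphere is the central projection of the uniform measure on the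
unit ball. -/
theorem lintegral_v {N : ℕ} (hN : 0 < N) {φ : E N → ℝ≥0∞} (hφ : Measurable φ) :
    ∫⁻ x, φ x ∂(v N) = (volume (Metric.ball (0 : E N) 1))⁻¹ *
      ∫⁻ x in Metric.ball (0 : E N) 1, φ ((√N / ‖x‖) • x) := by
  have : Nonempty (Fin N) := ⟨⟨0, hN⟩⟩
  have hS : Measurable fun u : Metric.sphere (0 : E N) 1 => √(N : ℝ) • (u : E N) :=
    Continuous.measurable (by fun_prop)
  set K : ℝ≥0∞ := ∫⁻ r in Ioi (0 : ℝ), ENNReal.ofReal (r ^ (Module.finrank ℝ (E N) - 1)) *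
    (Iio (1 : ℝ)).indicator 1 r with hK
  have hmK : Measurable fun r : ℝ => ENNReal.ofReal (r ^ (Module.finrank ℝ (E N) - 1)) *
      (Iio (1 : ℝ)).indicator (1 : ℝ → ℝ≥0∞) r :=
    (by fun_prop : Measurable fun r : ℝ => ENNReal.ofReal (r ^ (Module.finrank ℝ (E N) - 1))).mul
      (measurable_one.indicator measurableSet_Iio)
  -- The integrand depends only on direction, so the polar integral factors. The radial factor K is
  -- never evaluated: ψ = 1 expresses the volume of the ball through it, and it cancels.
  have key : ∀ ψ : E N → ℝ≥0∞, Measurable ψ →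
      ∫⁻ x in Metric.ball (0 : E N) 1, ψ ((√N / ‖x‖) • x) =
        K * ∫⁻ u : Metric.sphere (0 : E N) 1, ψ (√(N : ℝ) • (u : E N))
          ∂(volume : Measure (E N)).toSphere := by
    intro ψ hψ
    have hψm : Measurable fun x : E N => ψ ((√N / ‖x‖) • x) := by fun_prop
    rw [← lintegral_indicator measurableSet_ball,
      lintegral_polar volume (hψm.indicator measurableSet_ball),
      ← lintegral_const_mul _ (show Measurable fun u : Metric.sphere (0 : E N) 1 =>
        ψ (√(N : ℝ) • (u : E N)) from hψ.comp hS)]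
    refine lintegral_congr fun u => ?_
    have hu : ‖(u : E N)‖ = 1 := by simp
    rw [hK, ← lintegral_mul_const _ hmK]
    refine setLIntegral_congr_fun measurableSet_Ioi fun r hr => ?_
    have hr : 0 < r := hr
    have hn : ‖r • (u : E N)‖ = r := by rw [norm_smul, hu, mul_one, Real.norm_of_nonneg hr.le]
    by_cases h1 : r < 1
    · have hb : r • (u : E N) ∈ Metric.ball (0 : E N) 1 := by simpa [hn] using h1
      simp only [indicator_of_mem hb, indicator_of_mem (mem_Iio.2 h1), hn, smul_smul,
        div_mul_cancel₀ _ hr.ne', Pi.one_apply, mul_one]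
    · have hb : r • (u : E N) ∉ Metric.ball (0 : E N) 1 := by simpa [hn] using h1
      simp only [indicator_of_notMem hb, indicator_of_notMem (show r ∉ Iio 1 from h1), mul_zero,
        zero_mul]
  have hvol : volume (Metric.ball (0 : E N) 1) =
      K * (volume : Measure (E N)).toSphere univ := by
    simpa using key 1 measurable_one
  have hb0 : volume (Metric.ball (0 : E N) 1) ≠ 0 := (Metric.measure_ball_pos _ _ one_pos).ne'
  have hbt : volume (Metric.ball (0 : E N) 1) ≠ ∞ := measure_ball_lt_top.ne
  have hT0 : (volume : Measure (E N)).toSphere univ ≠ 0 := by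
    simpa using ⟨hN.ne', hb0⟩
  have hTt : (volume : Measure (E N)).toSphere univ ≠ ∞ := measure_ne_top _ _
  have hK0 : K ≠ 0 := fun h => hb0 (by rw [hvol, h, zero_mul])
  have hKt : K ≠ ∞ := fun h => hbt (by rw [hvol, h, ENNReal.top_mul hT0])
  rw [v, lintegral_map hφ hS, lintegral_smul_measure, key φ hφ, hvol,
    ENNReal.mul_inv (.inl hK0) (.inl hKt), smul_eq_mul, mul_mul_mul_comm,
    ENNReal.inv_mul_cancel hK0 hKt, one_mul]

theorem isProbabilityMeasure_v {N : ℕ} (hN : 0 < N) : IsProbabilityMeasure (v N) := by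
  have : Nonempty (Fin N) := ⟨⟨0, hN⟩⟩
  refine ⟨?_⟩
  have h := lintegral_v hN (φ := 1) measurable_one
  simpa [ENNReal.inv_mul_cancel (Metric.measure_ball_pos volume (0 : E N) one_pos).ne'
    measure_ball_lt_top.ne] using h

theorem measurable_proj (n N : ℕ) : Measurable (proj n N) := by
  refine (WithLp.measurable_toLp 2 _).comp (measurable_pi_lambda _ fun i => ?_)
  split_ifs
  · fun_prop
  · fun_prop

/-- The orthogonal splitting `ℝⁿ⁺ᵐ = ℝⁿ × ℝᵐ`. -/
def splitIso (n m : ℕ) : E (n + m) ≃ₗᵢ[ℝ] WithLp 2 (E n × E m) :=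
  (LinearIsometryEquiv.piLpCongrLeft 2 ℝ ℝ finSumFinEquiv.symm).trans
    (PiLp.sumPiLpEquivProdLpPiLp 2 (fun _ => ℝ))

theorem splitIso_fst (n m : ℕ) (x : E (n + m)) : (splitIso n m x).fst = proj n (n + m) x := by
  ext i
  have hi : (i : ℕ) < n + m := by omega
  change x.ofLp (finSumFinEquiv (Sum.inl i)) = _
  simp only [proj, hi, dite_true]
  rfl

theorem lintegral_split (n m : ℕ) {F : ℝ → E n → ℝ≥0∞} (hF : Measurable (Function.uncurry F)) :
    ∫⁻ x : E (n + m), F ‖x‖ (proj n (n + m) x) =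
      ∫⁻ z : E m, ∫⁻ y : E n, F √(‖y‖ ^ 2 + ‖z‖ ^ 2) y := by
  have hmp : MeasurePreserving (fun x : E (n + m) => WithLp.ofLp (splitIso n m x)) :=
    (WithLp.volume_preserving_ofLp (E n) (E m)).comp (splitIso n m).measurePreserving
  have hG : Measurable fun p : E n × E m => F √(‖p.1‖ ^ 2 + ‖p.2‖ ^ 2) p.1 :=
    hF.comp (f := fun p : E n × E m => (√(‖p.1‖ ^ 2 + ‖p.2‖ ^ 2), p.1)) (by fun_prop)
  have h := hmp.lintegral_comp hG
  rw [Measure.volume_eq_prod, lintegral_prod_symm _ hG.aemeasurable] at h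
  rw [← h]
  refine lintegral_congr fun x => ?_
  have hn : ‖x‖ = √(‖(splitIso n m x).fst‖ ^ 2 + ‖(splitIso n m x).snd‖ ^ 2) := by
    rw [← WithLp.prod_norm_sq_eq_of_L2, Real.sqrt_sq (norm_nonneg _),
      LinearIsometryEquiv.norm_map]
  rw [hn, ← splitIso_fst]
  rfl

theorem lintegral_comp_smul_addHaar {V : Type*} [NormedAddCommGroup V] [NormedSpace ℝ V]
    [MeasurableSpace V] [BorelSpace V] [FiniteDimensional ℝ V] (μ : Measure V)
    [μ.IsAddHaarMeasure] {R : ℝ} (hR : 0 < R) {g : V → ℝ≥0∞} (hg : Measurable g) :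
    ∫⁻ x, g x ∂μ = ENNReal.ofReal (R ^ Module.finrank ℝ V) * ∫⁻ x, g (R • x) ∂μ := by
  rw [← lintegral_map hg (measurable_const_smul R), Measure.map_addHaar_smul μ hR.ne',
    lintegral_smul_measure, smul_eq_mul, ← mul_assoc,
    abs_of_pos (by positivity), ← ENNReal.ofReal_mul (by positivity),
    mul_inv_cancel₀ (by positivity), ENNReal.ofReal_one, one_mul]

end Sphere

/-! ### The radial map from Euclidean space onto the ball -/

section Gnomonic

/-- The multiplier of the radial map `w ↦ √N w / √(1 + |w|²)` of `ℝⁿ` onto the ball of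
radius `√N`. -/
def ballMultiplier (N : ℕ) (t : ℝ) : ℝ := √N / √(1 + t ^ 2)

theorem s_ballMultiplier {V : Type*} [NormedAddCommGroup V] [NormedSpace ℝ V] (N : ℕ) (w : V) :
    s (ballMultiplier N) w = (√N / √(1 + ‖w‖ ^ 2)) • w := by
  by_cases hw : w = 0
  · simp [s, hw]
  · rw [s_of_ne_zero hw, ballMultiplier]

theorem s_ballMultiplier_real (N : ℕ) (t : ℝ) :
    s (ballMultiplier N) t = √N * (t / √(1 + t ^ 2)) := by
  rw [s_ballMultiplier, Real.norm_eq_abs, sq_abs, smul_eq_mul]; ring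

theorem hasDerivAt_s_ballMultiplier (N : ℕ) (t : ℝ) :
    HasDerivAt (s (ballMultiplier N) : ℝ → ℝ) (√N * (√(1 + t ^ 2) ^ 3)⁻¹) t := by
  have hp : 0 < 1 + t ^ 2 := by positivity
  have hq : 0 < √(1 + t ^ 2) := Real.sqrt_pos.2 hp
  have hsq : √(1 + t ^ 2) ^ 2 = 1 + t ^ 2 := Real.sq_sqrt hp.le
  have h1 : HasDerivAt (fun t : ℝ => √(1 + t ^ 2)) (2 * t / (2 * √(1 + t ^ 2))) t := by
    have := ((hasDerivAt_id t).pow 2).const_add 1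
    simpa using this.sqrt hp.ne'
  have h2 := ((hasDerivAt_id t).div h1 hq.ne').const_mul √(N : ℝ)
  have h3 : (s (ballMultiplier N) : ℝ → ℝ) = fun t => √N * (t / √(1 + t ^ 2)) :=
    funext (s_ballMultiplier_real N)
  rw [h3]
  refine HasDerivAt.congr_deriv (f := fun t : ℝ => √N * (t / √(1 + t ^ 2))) h2 ?_
  simp only [id, one_mul]
  field_simp
  rw [hsq]; ring

theorem conditionC_ballMultiplier {N : ℕ} (hN : 0 < N) : ConditionC (ballMultiplier N) where
  contDiffOn := by
    refine ContDiff.contDiffOn (ContDiff.div contDiff_const (ContDiff.sqrt (by fun_prop) ?_) ?_)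
    · intro t; positivity
    · intro t; positivity
  pos r _ := by unfold ballMultiplier; positivity
  strictMono := by
    refine strictMono_of_deriv_pos fun t => ?_
    rw [(hasDerivAt_s_ballMultiplier N t).deriv]
    positivity

theorem leftInverse_s_ballMultiplier {N : ℕ} (hN : 0 < N) :
    Function.LeftInverse (fun t => t / √(N - t ^ 2)) (s (ballMultiplier N) : ℝ → ℝ) := by
  intro t
  have hN' : (0 : ℝ) < N := by exact_mod_cast hN
  have h : (N : ℝ) - (s (ballMultiplier N) t) ^ 2 = N / (1 + t ^ 2) := by
    rw [s_ballMultiplier_real, mul_pow, div_pow, Real.sq_sqrt hN'.le,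
      Real.sq_sqrt (by positivity)]
    field_simp
    ring
  simp only [h]
  rw [s_ballMultiplier_real, Real.sqrt_div hN'.le]
  field_simp

theorem radii_ballMultiplier {N : ℕ} (hN : 0 < N) : radii (ballMultiplier N) = Ioo 0 √N := by
  have hN' : (0 : ℝ) < N := by exact_mod_cast hN
  ext t
  constructor
  · rintro ⟨r, hr, rfl⟩
    refine ⟨(conditionC_ballMultiplier hN).s_pos hr, ?_⟩
    rw [s_ballMultiplier_real]
    refine mul_lt_of_lt_one_right (by positivity) ?_
    rw [div_lt_one (by positivity)]
    exact Real.lt_sqrt_of_sq_lt (by linarith)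
  · rintro ⟨h0, h1⟩
    have hlt : t ^ 2 < N := (Real.lt_sqrt h0.le).1 h1
    have hd : 0 < (N : ℝ) - t ^ 2 := by linarith
    refine ⟨t / √(N - t ^ 2), by simp only [mem_Ioi]; positivity, ?_⟩
    have : 1 + (t / √(N - t ^ 2)) ^ 2 = N / (N - t ^ 2) := by
      rw [div_pow, Real.sq_sqrt hd.le]; field_simp; ring
    rw [s_ballMultiplier_real, this, Real.sqrt_div hN'.le]
    field_simp

/-- The density of the projection of the uniform measure on the sphere, up to a factor. -/
def sphereProfile (n N : ℕ) (t : ℝ) : ℝ :=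
  (Iio √(N : ℝ)).indicator (fun t => (1 - t ^ 2 / N) ^ (((N : ℝ) - n - 2) / 2)) t

theorem measurable_sphereProfile (n N : ℕ) : Measurable (sphereProfile n N) := by
  refine Measurable.indicator ?_ measurableSet_Iio
  fun_prop

/-- With w = 1 - t²/N one has 1 + σ² = 1/w, so the density contributes w^(N/2), the n - 1 ratios σ/t
contribute w^(-1/2) each, and σ' contributes w^(-3/2). The exponents add up to (N - n - 2)/2. -/
theorem radialDensity_ballMultiplier {n N : ℕ} (hn : 1 ≤ n) (hN : 0 < N) {t : ℝ} (ht : 0 < t) :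
    radialDensity (ballMultiplier N) (fun t => t / √(N - t ^ 2)) (n - 1)
      (fun r => ENNReal.ofReal ((1 + r ^ 2) ^ (-(N : ℝ) / 2))) t =
    ENNReal.ofReal ((√N)⁻¹ ^ n) * ENNReal.ofReal (sphereProfile n N t) := by
  have hN' : (0 : ℝ) < N := by exact_mod_cast hN
  have hmem : t ∈ radii (ballMultiplier N) ↔ t < √N := by
    rw [radii_ballMultiplier hN]; simp [ht]
  by_cases h : t < √N
  swap
  · rw [radialDensity, indicator_of_notMem (hmem.not.2 h), sphereProfile,
      indicator_of_notMem (by simpa using h)]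
    simp
  have hr := hmem.2 h
  have hlt : t ^ 2 < N := (Real.lt_sqrt ht.le).1 h
  have hd : 0 < (N : ℝ) - t ^ 2 := by linarith
  rw [radialDensity, indicator_of_mem hr, sphereProfile, indicator_of_mem (by simpa using h),
    (conditionC_ballMultiplier hN).extDeriv_inverse (leftInverse_s_ballMultiplier hN) hr,
    (hasDerivAt_s_ballMultiplier N _).deriv]
  set w : ℝ := 1 - t ^ 2 / N with hw
  have hNw : (N : ℝ) - t ^ 2 = N * w := by rw [hw]; field_simp
  have hw0 : 0 < w := by
    have : 0 < N * w := hNw ▸ hd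
    exact pos_of_mul_pos_right this hN'.le
  have hσ : 1 + (t / √(N - t ^ 2)) ^ 2 = w⁻¹ := by
    rw [div_pow, Real.sq_sqrt hd.le, hNw]; field_simp; rw [hw]; field_simp; ring
  have hq : t / √(N - t ^ 2) / t = (√N)⁻¹ * w ^ (-(1 / 2) : ℝ) := by
    rw [hNw, Real.sqrt_mul hN'.le, Real.rpow_neg hw0.le, ← Real.sqrt_eq_rpow]; field_simp
  have hc : (√N * (√w⁻¹ ^ 3)⁻¹)⁻¹ = (√N)⁻¹ * w ^ (-(3 / 2) : ℝ) := by
    rw [mul_inv, inv_inv, Real.sqrt_inv, inv_pow, Real.rpow_neg hw0.le, Real.sqrt_eq_rpow w,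
      ← Real.rpow_natCast (w ^ _), ← Real.rpow_mul hw0.le]
    norm_num
  rw [hσ, hq, ← ENNReal.ofReal_inv_of_pos (by positivity), hc,
    ← ENNReal.ofReal_mul (by positivity), ← ENNReal.ofReal_mul (by positivity),
    ← ENNReal.ofReal_mul (by positivity)]
  congr 1
  obtain ⟨d, rfl⟩ : ∃ d, n = d + 1 := ⟨n - 1, by omega⟩
  rw [Nat.add_sub_cancel, mul_pow, Real.inv_rpow hw0.le, ← Real.rpow_neg hw0.le,
    ← Real.rpow_natCast (w ^ _), ← Real.rpow_mul hw0.le]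
  have : w ^ (((N : ℝ) - (d + 1 : ℕ) - 2) / 2) =
      w ^ (-(-(N : ℝ) / 2)) * w ^ (-(1 / 2) * (d : ℝ)) * w ^ (-(3 / 2) : ℝ) := by
    rw [← Real.rpow_add hw0, ← Real.rpow_add hw0]; congr 1; push_cast; ring
  rw [this, pow_succ]
  ring

end Gnomonic

/-! ### The law of the projection of the sphere -/

section Projection

theorem proj_smul (n N : ℕ) (a : ℝ) (x : E N) : proj n N (a • x) = a • proj n N x := by
  ext i
  by_cases h : (i : ℕ) < N <;> simp [proj, h]

/-- Rescaling z by 1/√q produces m factors 1/√q from the volume and n from ‖z‖ ^ n. -/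
theorem lintegral_slice {m : ℕ} (n : ℕ) {q : ℝ} (hq : 0 < q) :
    ∫⁻ z : E m, ENNReal.ofReal (‖z‖ ^ n) * (Iio (1 : ℝ)).indicator 1 (‖z‖ * √q) =
      ENNReal.ofReal (q ^ (-((n + m : ℕ) : ℝ) / 2)) *
        ∫⁻ z : E m, ENNReal.ofReal (‖z‖ ^ n) * (Iio (1 : ℝ)).indicator 1 ‖z‖ := by
  have hi : Measurable ((Iio (1 : ℝ)).indicator (1 : ℝ → ℝ≥0∞)) :=
    measurable_one.indicator measurableSet_Iio
  have hsq : 0 < √q := Real.sqrt_pos.2 hq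
  rw [lintegral_comp_smul_addHaar volume (inv_pos.2 hsq) (by fun_prop),
    finrank_euclideanSpace_fin]
  have h : ∀ z : E m, ENNReal.ofReal (‖(√q)⁻¹ • z‖ ^ n) *
      (Iio (1 : ℝ)).indicator (1 : ℝ → ℝ≥0∞) (‖(√q)⁻¹ • z‖ * √q) = ENNReal.ofReal ((√q)⁻¹ ^ n) *
      (ENNReal.ofReal (‖z‖ ^ n) * (Iio (1 : ℝ)).indicator 1 ‖z‖) := by
    intro z
    rw [norm_smul, Real.norm_of_nonneg (inv_pos.2 hsq).le, mul_pow,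
      ENNReal.ofReal_mul (by positivity), mul_assoc]
    congr 4
    field_simp
  simp only [h]
  rw [lintegral_const_mul _ (by fun_prop), ← mul_assoc, ← ENNReal.ofReal_mul (by positivity)]
  congr 2
  rw [← pow_add, Real.sqrt_eq_rpow, ← Real.rpow_neg hq.le, ← Real.rpow_natCast,
    ← Real.rpow_mul hq.le]
  congr 1
  push_cast
  ring

/-- The projection of the uniform measure on the sphere is the image of a measure with an explicit
radial density under a radial map. -/
theorem exists_map_proj_v_eq_map {n m : ℕ} (hm : 1 ≤ m) :
    ∃ C : ℝ≥0∞, (v (n + m)).map (proj n (n + m)) =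
      C • ((volume : Measure (E n)).withDensity fun w =>
        ENNReal.ofReal ((1 + ‖w‖ ^ 2) ^ (-((n + m : ℕ) : ℝ) / 2))).map
          (s (ballMultiplier (n + m))) := by
  have hN : 0 < n + m := by omega
  have : Nonempty (Fin m) := ⟨⟨0, hm⟩⟩
  have hi : Measurable ((Iio (1 : ℝ)).indicator (1 : ℝ → ℝ≥0∞)) :=
    measurable_one.indicator measurableSet_Iio
  have hs : Measurable (s (ballMultiplier (n + m)) : E n → E n) :=
    (conditionC_ballMultiplier hN).measurable_s
  -- The value of J is not needed; `map_proj_v` later fixes the constant by total mass.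
  set J : ℝ≥0∞ := ∫⁻ z : E m, ENNReal.ofReal (‖z‖ ^ n) * (Iio (1 : ℝ)).indicator 1 ‖z‖
  refine ⟨(volume (Metric.ball (0 : E (n + m)) 1))⁻¹ * J,
    Measure.ext_of_lintegral _ fun φ hφ => ?_⟩
  have hφp : Measurable fun x => φ (proj n (n + m) x) := hφ.comp (measurable_proj _ _)
  have hφs : Measurable fun w : E n => φ (s (ballMultiplier (n + m)) w) := hφ.comp hs
  let F : ℝ → E n → ℝ≥0∞ := fun a y =>
    (Iio (1 : ℝ)).indicator 1 a * φ ((√((n + m : ℕ) : ℝ) / a) • y)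
  have hF : Measurable (Function.uncurry F) := by
    simp only [F, Function.uncurry_def]
    fun_prop
  have hball : ∫⁻ x in Metric.ball (0 : E (n + m)) 1,
      φ (proj n (n + m) ((√((n + m : ℕ) : ℝ) / ‖x‖) • x)) =
      ∫⁻ x : E (n + m), F ‖x‖ (proj n (n + m) x) := by
    rw [← lintegral_indicator measurableSet_ball]
    refine lintegral_congr fun x => ?_
    by_cases hx : ‖x‖ < 1
    · simp [F, hx, proj_smul]
    · simp [F, hx]
  -- Substituting y = ‖z‖ w gives the Jacobian ‖z‖ ^ n, and (y, z) has norm ‖z‖ √(1 + ‖w‖²), so ‖z‖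
  -- cancels in the argument of φ. The excluded z = 0 is null since m ≥ 1.
  have hslice : ∀ᵐ z : E m, ∫⁻ y : E n, F √(‖y‖ ^ 2 + ‖z‖ ^ 2) y = ∫⁻ w : E n,
      ENNReal.ofReal (‖z‖ ^ n) * (Iio (1 : ℝ)).indicator 1 (‖z‖ * √(1 + ‖w‖ ^ 2)) *
        φ (s (ballMultiplier (n + m)) w) := by
    filter_upwards [compl_mem_ae_iff.2 (measure_singleton (0 : E m))] with z hz
    have hz0 : 0 < ‖z‖ := norm_pos_iff.2 hz
    have hFz : Measurable fun y : E n => F √(‖y‖ ^ 2 + ‖z‖ ^ 2) y :=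
      hF.comp (f := fun y : E n => (√(‖y‖ ^ 2 + ‖z‖ ^ 2), y)) (by fun_prop)
    rw [lintegral_comp_smul_addHaar volume hz0 hFz, finrank_euclideanSpace_fin,
      ← lintegral_const_mul _ (by fun_prop)]
    refine lintegral_congr fun w => ?_
    have hsq : √(‖‖z‖ • w‖ ^ 2 + ‖z‖ ^ 2) = ‖z‖ * √(1 + ‖w‖ ^ 2) := by
      rw [norm_smul, norm_norm, ← Real.sqrt_sq hz0.le, ← Real.sqrt_mul (by positivity),
        Real.sqrt_sq hz0.le]
      congr 1
      ring
    simp only [F]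
    rw [hsq, smul_smul, s_ballMultiplier, mul_assoc]
    congr 4
    field_simp
  rw [lintegral_map hφ (measurable_proj _ _), lintegral_v hN hφp, hball, lintegral_split n m hF,
    lintegral_congr_ae hslice, lintegral_lintegral_swap (by
      simp only [Function.uncurry_def]
      fun_prop), lintegral_smul_measure, lintegral_map hφ hs,
    lintegral_withDensity_eq_lintegral_mul _ (by fun_prop) hφs, smul_eq_mul, mul_assoc]
  congr 1
  rw [← lintegral_const_mul _ (by fun_prop)]
  refine lintegral_congr fun w => ?_
  rw [lintegral_mul_const _ (by fun_prop), lintegral_slice n (by positivity), Pi.mul_apply]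
  ring

/-- The constant that normalizes `sphereProfile`. -/
def sphereConst (n N : ℕ) : ℝ≥0∞ :=
  (∫⁻ y : E n, ENNReal.ofReal (sphereProfile n N ‖y‖))⁻¹

theorem map_proj_v {n N : ℕ} (hn : 1 ≤ n) (hN : n < N) :
    (v N).map (proj n N) = (volume : Measure (E n)).withDensity fun y =>
      sphereConst n N * ENNReal.ofReal (sphereProfile n N ‖y‖) := by
  have hp : Measurable fun y : E n => ENNReal.ofReal (sphereProfile n N ‖y‖) :=
    ((measurable_sphereProfile n N).comp measurable_norm).ennreal_ofReal
  have hN0 : 0 < N := by omega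
  have : Nonempty (Fin n) := ⟨⟨0, hn⟩⟩
  obtain ⟨C, hC⟩ : ∃ C : ℝ≥0∞, (v N).map (proj n N) =
      C • (volume : Measure (E n)).withDensity fun y =>
        ENNReal.ofReal (sphereProfile n N ‖y‖) := by
    obtain ⟨m, rfl⟩ := Nat.exists_eq_add_of_lt hN
    rw [add_assoc] at *
    obtain ⟨C, hC⟩ := exists_map_proj_v_eq_map (n := n) (m := m + 1) (by omega)
    refine ⟨C * ENNReal.ofReal ((√((n + (m + 1) : ℕ) : ℝ))⁻¹ ^ n), ?_⟩
    have hcrit : volume {r : ℝ | 0 < r ∧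
        deriv (s (ballMultiplier (n + (m + 1))) : ℝ → ℝ) r = 0} = 0 := by
      convert measure_empty (μ := (volume : Measure ℝ))
      refine eq_empty_of_forall_notMem fun r hr => ?_
      have h := hr.2
      rw [(hasDerivAt_s_ballMultiplier _ r).deriv] at h
      exact absurd h (by positivity)
    rw [hC, (conditionC_ballMultiplier hN0).map_s_withDensity
      (leftInverse_s_ballMultiplier hN0) hcrit volume
      (h := fun r => ENNReal.ofReal ((1 + r ^ 2) ^ (-((n + (m + 1) : ℕ) : ℝ) / 2)))
      (by fun_prop), mul_smul, ← withDensity_smul _ hp, finrank_euclideanSpace_fin]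
    congr 1
    refine withDensity_congr_ae ?_
    filter_upwards [compl_mem_ae_iff.2 (measure_singleton (0 : E n))] with x hx
    exact radialDensity_ballMultiplier hn hN0 (norm_pos_iff.2 hx)
  have hprob : IsProbabilityMeasure ((v N).map (proj n N)) := by
    have := isProbabilityMeasure_v hN0
    exact Measure.isProbabilityMeasure_map (measurable_proj _ _).aemeasurable
  have h1 := hprob.measure_univ
  rw [hC, Measure.smul_apply, withDensity_apply _ .univ, Measure.restrict_univ, smul_eq_mul] at h1
  -- Both sides are probability measures, which determines C.
  have hCeq : C = sphereConst n N := ENNReal.eq_inv_of_mul_eq_one_left h1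
  rw [hC, hCeq, ← withDensity_smul _ hp]
  rfl

end Projection

/-! ### Convergence to the Gaussian -/

section GaussianLimit

theorem sphereProfile_nonneg (n N : ℕ) {t : ℝ} (ht : 0 ≤ t) : 0 ≤ sphereProfile n N t := by
  refine indicator_apply_nonneg fun h => Real.rpow_nonneg ?_ _
  have hlt : t ^ 2 < N := (Real.lt_sqrt ht).1 h
  have : (0 : ℝ) < N := (sq_nonneg t).trans_lt hlt
  rw [sub_nonneg, div_le_one this]
  exact hlt.le

theorem tendsto_sphereProfile (n : ℕ) (t : ℝ) :
    Tendsto (fun N : ℕ => sphereProfile n N t) atTop (𝓝 (Real.exp (-t ^ 2 / 2))) := by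
  have hsqrt : ∀ᶠ N : ℕ in atTop, t < √(N : ℝ) :=
    (Real.tendsto_sqrt_atTop.comp tendsto_natCast_atTop_atTop).eventually_gt_atTop t
  have hlarge : ∀ᶠ N : ℕ in atTop, t ^ 2 < (N : ℝ) :=
    tendsto_natCast_atTop_atTop.eventually_gt_atTop _
  have h1 : Tendsto (fun N : ℕ => ((1 + -t ^ 2 / (N : ℝ)) ^ N) ^ (1 / 2 : ℝ)) atTop
      (𝓝 (Real.exp (-t ^ 2) ^ (1 / 2 : ℝ))) :=
    (Real.tendsto_one_add_div_pow_exp (-t ^ 2)).rpow_const (.inr (by norm_num))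
  have h2 : Tendsto (fun N : ℕ => (1 + -t ^ 2 / (N : ℝ)) ^ (-((n : ℝ) + 2) / 2)) atTop (𝓝 1) := by
    have h := (tendsto_const_div_atTop_nhds_zero_nat (-t ^ 2)).const_add 1
    rw [add_zero] at h
    simpa using h.rpow_const (p := -((n : ℝ) + 2) / 2) (.inl one_ne_zero)
  have h3 := h1.mul h2
  rw [mul_one, ← Real.exp_mul, mul_one_div] at h3
  refine h3.congr' ?_
  filter_upwards [hsqrt, hlarge] with N hN hN'
  have hNpos : (0 : ℝ) < N := (sq_nonneg t).trans_lt hN'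
  have hb : 0 < 1 + -t ^ 2 / (N : ℝ) := by
    rw [neg_div, ← sub_eq_add_neg, sub_pos, div_lt_one hNpos]; exact hN'
  rw [sphereProfile, indicator_of_mem (mem_Iio.2 hN), ← Real.rpow_natCast, ← Real.rpow_mul hb.le,
    ← Real.rpow_add hb, neg_div, ← sub_eq_add_neg]
  congr 1
  ring

/-- The condition on N says exactly that (N - n - 2)/2 ≥ N/4; then 1 - x ≤ exp(-x) applies with x =
t²/N. The bound is uniform in N and serves as the dominating function. -/
theorem sphereProfile_le {n N : ℕ} (hN : 2 * n + 4 ≤ N) {t : ℝ} (ht : 0 ≤ t) :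
    sphereProfile n N t ≤ Real.exp (-(1 / 4) * t ^ 2) := by
  rw [sphereProfile]
  refine indicator_apply_le' (fun h => ?_) (fun _ => (Real.exp_pos _).le)
  have hlt : t ^ 2 < N := (Real.lt_sqrt ht).1 h
  have hNpos : (0 : ℝ) < N := (sq_nonneg t).trans_lt hlt
  have hN' : 2 * (n : ℝ) + 4 ≤ N := by exact_mod_cast hN
  have hk : (N : ℝ) / 4 ≤ ((N : ℝ) - n - 2) / 2 := by linarith
  have hb : 0 ≤ 1 - t ^ 2 / N := by rw [sub_nonneg, div_le_one hNpos]; exact hlt.le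
  calc (1 - t ^ 2 / N) ^ (((N : ℝ) - n - 2) / 2)
      ≤ Real.exp (-(t ^ 2 / N)) ^ (((N : ℝ) - n - 2) / 2) :=
        Real.rpow_le_rpow hb (Real.one_sub_le_exp_neg _) (by linarith)
    _ = Real.exp (-(t ^ 2 / N) * (((N : ℝ) - n - 2) / 2)) := (Real.exp_mul _ _).symm
    _ ≤ Real.exp (-(1 / 4) * t ^ 2) := by
        refine Real.exp_le_exp.2 ?_
        have := mul_le_mul_of_nonneg_left hk (by positivity : 0 ≤ t ^ 2 / N)
        have e : t ^ 2 / N * (N / 4) = 1 / 4 * t ^ 2 := by field_simp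
        linarith

theorem integrable_exp_neg_mul_sq_norm (n : ℕ) {b : ℝ} (hb : 0 < b) :
    Integrable fun y : E n => Real.exp (-b * ‖y‖ ^ 2) := by
  -- A non-integrable function has Bochner integral 0, whereas the Gaussian integral formula gives a
  -- positive value.
  by_contra h
  have h1 := GaussianFourier.integral_rexp_neg_mul_sq_norm (V := E n) hb
  rw [integral_undef h] at h1
  exact (Real.rpow_pos_of_pos (div_pos Real.pi_pos hb) _).ne h1

theorem measurable_sphereProfile_norm (n N : ℕ) :
    Measurable fun y : E n => sphereProfile n N ‖y‖ :=
  (measurable_sphereProfile n N).comp measurable_norm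

/-- Only measurability of G is required, because G will be g ∘ `s ρ`, which may be discontinuous at
the origin. -/
theorem tendsto_integral_mul_sphereProfile (n : ℕ) {G : E n → ℝ} (hG : Measurable G) {M : ℝ}
    (hM : ∀ y, |G y| ≤ M) :
    Tendsto (fun N : ℕ => ∫ y, sphereProfile n N ‖y‖ * G y) atTop
      (𝓝 (∫ y, Real.exp (-‖y‖ ^ 2 / 2) * G y)) := by
  refine tendsto_integral_filter_of_dominated_convergence
    (fun y => Real.exp (-(1 / 4) * ‖y‖ ^ 2) * M) ?_ ?_
    ((integrable_exp_neg_mul_sq_norm n (by norm_num)).mul_const M) ?_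
  · exact .of_forall fun N => ((measurable_sphereProfile_norm n N).mul hG).aestronglyMeasurable
  · filter_upwards [eventually_ge_atTop (2 * n + 4)] with N hN
    refine .of_forall fun y => ?_
    rw [norm_mul, Real.norm_of_nonneg (sphereProfile_nonneg n N (norm_nonneg y))]
    exact mul_le_mul (sphereProfile_le hN (norm_nonneg y)) (hM y) (norm_nonneg _)
      (Real.exp_pos _).le
  · exact .of_forall fun y => (tendsto_sphereProfile n ‖y‖).mul_const _

theorem integral_exp_neg_sq_norm_div_two (n : ℕ) :
    ∫ y : E n, Real.exp (-‖y‖ ^ 2 / 2) = (2 * Real.pi) ^ ((n : ℝ) / 2) := by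
  have h := GaussianFourier.integral_rexp_neg_mul_sq_norm (V := E n) (b := 1 / 2) (by norm_num)
  rw [finrank_euclideanSpace_fin] at h
  convert h using 2
  · ext y; congr 1; ring
  · ring

theorem tendsto_sphereConst (n : ℕ) :
    Tendsto (sphereConst n) atTop (𝓝 (ENNReal.ofReal ((2 * Real.pi) ^ (-(n : ℝ) / 2)))) := by
  have h := tendsto_integral_mul_sphereProfile n (G := fun _ => 1) measurable_const (M := 1)
    (by simp)
  simp only [mul_one, integral_exp_neg_sq_norm_div_two] at h
  have h1 := (continuous_inv.tendsto _).comp ((ENNReal.continuous_ofReal.tendsto _).comp h)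
  rw [← ENNReal.ofReal_inv_of_pos (by positivity), ← Real.rpow_neg (by positivity),
    ← neg_div] at h1
  refine h1.congr' ?_
  filter_upwards [eventually_ge_atTop (2 * n + 4)] with N hN
  simp only [Function.comp_apply, sphereConst]
  rw [ofReal_integral_eq_lintegral_ofReal]
  · refine (integrable_exp_neg_mul_sq_norm n (b := 1 / 4) (by norm_num)).mono'
      (measurable_sphereProfile_norm n N).aestronglyMeasurable (.of_forall fun y => ?_)
    rw [Real.norm_of_nonneg (sphereProfile_nonneg n N (norm_nonneg y))]
    exact sphereProfile_le hN (norm_nonneg y)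
  · exact .of_forall fun y => sphereProfile_nonneg n N (norm_nonneg y)

theorem sphereConst_ne_zero_and_ne_top {n N : ℕ} (hn : 1 ≤ n) (hN : n < N) :
    sphereConst n N ≠ 0 ∧ sphereConst n N ≠ ∞ := by
  have hp : Measurable fun y : E n => ENNReal.ofReal (sphereProfile n N ‖y‖) :=
    (measurable_sphereProfile_norm n N).ennreal_ofReal
  have := isProbabilityMeasure_v (N := N) (by omega)
  have hprob : IsProbabilityMeasure ((v N).map (proj n N)) :=
    Measure.isProbabilityMeasure_map (measurable_proj _ _).aemeasurable
  have h1 := hprob.measure_univ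
  rw [map_proj_v hn hN, withDensity_apply _ .univ, Measure.restrict_univ,
    lintegral_const_mul _ hp] at h1
  refine ⟨fun h => by simp [h] at h1, fun h => ?_⟩
  rw [sphereConst, ENNReal.inv_eq_top] at h
  simp [h] at h1

end GaussianLimit

/-! ### Image densities and weak convergence -/

section Densities

variable {n N : ℕ} {ρ σ : ℝ → ℝ}

/-- The radial profile of the density of the projected uniform measure. -/
def sphereDensity (n N : ℕ) (t : ℝ) : ℝ≥0∞ :=
  sphereConst n N * ENNReal.ofReal (sphereProfile n N t)

/-- The radial profile of the standard Gaussian density on `ℝⁿ`. -/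
def gaussianDensity (n : ℕ) (t : ℝ) : ℝ≥0∞ :=
  ENNReal.ofReal ((2 * Real.pi) ^ (-(n : ℝ) / 2) * Real.exp (-t ^ 2 / 2))

theorem measurable_sphereDensity (n N : ℕ) : Measurable (sphereDensity n N) :=
  (measurable_sphereProfile n N).ennreal_ofReal.const_mul _

theorem measurable_gaussianDensity (n : ℕ) : Measurable (gaussianDensity n) := by
  unfold gaussianDensity; fun_prop

theorem tendsto_sphereDensity (n : ℕ) (t : ℝ) :
    Tendsto (fun N => sphereDensity n N t) atTop (𝓝 (gaussianDensity n t)) := by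
  rw [gaussianDensity, ENNReal.ofReal_mul (by positivity)]
  exact ENNReal.Tendsto.mul (tendsto_sphereConst n) (.inr ENNReal.ofReal_ne_top)
    ((ENNReal.continuous_ofReal.tendsto _).comp (tendsto_sphereProfile n t))
    (.inr ENNReal.ofReal_ne_top)

theorem pushforward_eq_map (hρ : ConditionC ρ) (hn : 1 ≤ n) (hN : n < N) :
    pushforward ρ n N =
      ((volume : Measure (E n)).withDensity fun y => sphereDensity n N ‖y‖).map (s ρ) := by
  rw [pushforward, show P ρ n N = s ρ ∘ proj n N from rfl,
    ← Measure.map_map hρ.measurable_s (measurable_proj n N), map_proj_v hn hN]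
  rfl

theorem pushforward_eq_withDensity (hρ : ConditionC ρ)
    (hσ : Function.LeftInverse σ (s ρ : ℝ → ℝ))
    (hcrit : volume {r : ℝ | 0 < r ∧ deriv (s ρ : ℝ → ℝ) r = 0} = 0) (hn : 1 ≤ n) (hN : n < N) :
    pushforward ρ n N = (volume : Measure (E n)).withDensity fun x =>
      radialDensity ρ σ (n - 1) (sphereDensity n N) ‖x‖ := by
  have : Nonempty (Fin n) := ⟨⟨0, hn⟩⟩
  rw [pushforward_eq_map hρ hn hN, hρ.map_s_withDensity hσ hcrit volume
    (measurable_sphereDensity n N), finrank_euclideanSpace_fin]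

theorem isProbabilityMeasure_pushforward (hρ : ConditionC ρ) (hN : n < N) :
    IsProbabilityMeasure (pushforward ρ n N) := by
  have := isProbabilityMeasure_v (N := N) (by omega)
  exact Measure.isProbabilityMeasure_map
    (hρ.measurable_s.comp (measurable_proj n N)).aemeasurable

theorem f_eq_radialDensity (hρ : ConditionC ρ) (σ : ℝ → ℝ) (x : E n) :
    f ρ σ n x = radialDensity ρ σ (n - 1) (gaussianDensity n) ‖x‖ := by
  rw [f, radialDensity]
  by_cases hx : ‖x‖ ∈ radii ρ
  · rw [if_pos (hρ.mem_image_s_iff.2 hx), indicator_of_mem hx, gaussianDensity,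
      ← ENNReal.ofReal_mul (by positivity)]
  · rw [if_neg (hρ.mem_image_s_iff.not.2 hx), indicator_of_notMem hx]

theorem ν_eq_map (hρ : ConditionC ρ) (hσ : Function.LeftInverse σ (s ρ : ℝ → ℝ))
    (hcrit : volume {r : ℝ | 0 < r ∧ deriv (s ρ : ℝ → ℝ) r = 0} = 0) (hn : 1 ≤ n) :
    ν ρ σ n = ((volume : Measure (E n)).withDensity fun y => gaussianDensity n ‖y‖).map (s ρ) := by
  have : Nonempty (Fin n) := ⟨⟨0, hn⟩⟩
  rw [hρ.map_s_withDensity hσ hcrit volume (measurable_gaussianDensity n),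
    finrank_euclideanSpace_fin, ν]
  congr 1
  ext1 x
  exact f_eq_radialDensity hρ σ x

theorem lintegral_gaussianDensity (n : ℕ) : ∫⁻ y : E n, gaussianDensity n ‖y‖ = 1 := by
  have hint : Integrable fun y : E n => Real.exp (-‖y‖ ^ 2 / 2) := by
    convert integrable_exp_neg_mul_sq_norm n (b := 1 / 2) (by norm_num) using 3
    ring
  simp only [gaussianDensity]
  rw [← ofReal_integral_eq_lintegral_ofReal (hint.const_mul _)
    (.of_forall fun y => by positivity), integral_const_mul, integral_exp_neg_sq_norm_div_two,
    ← Real.rpow_add (by positivity), neg_div, neg_add_cancel, Real.rpow_zero, ENNReal.ofReal_one]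

theorem isProbabilityMeasure_ν (hρ : ConditionC ρ) (hσ : Function.LeftInverse σ (s ρ : ℝ → ℝ))
    (hcrit : volume {r : ℝ | 0 < r ∧ deriv (s ρ : ℝ → ℝ) r = 0} = 0) (hn : 1 ≤ n) :
    IsProbabilityMeasure (ν ρ σ n) := by
  rw [ν_eq_map hρ hσ hcrit hn]
  have : IsProbabilityMeasure
      ((volume : Measure (E n)).withDensity fun y => gaussianDensity n ‖y‖) :=
    ⟨by rw [withDensity_apply _ .univ, Measure.restrict_univ, lintegral_gaussianDensity]⟩
  exact Measure.isProbabilityMeasure_map hρ.measurable_s.aemeasurable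

/-- Both integrals are pulled back through `s ρ`, which leaves the bounded test function g ∘ `s ρ`
against the sphere and Gaussian densities. -/
theorem tendsto_integral_pushforward (hρ : ConditionC ρ)
    (hσ : Function.LeftInverse σ (s ρ : ℝ → ℝ))
    (hcrit : volume {r : ℝ | 0 < r ∧ deriv (s ρ : ℝ → ℝ) r = 0} = 0) (hn : 1 ≤ n)
    (g : E n →ᵇ ℝ) :
    Tendsto (fun N : ℕ => ∫ x, g x ∂(pushforward ρ n N)) atTop (𝓝 (∫ x, g x ∂(ν ρ σ n))) := by
  have hs : Measurable (s ρ : E n → E n) := hρ.measurable_s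
  have hgs : Measurable fun y : E n => g (s ρ y) := g.continuous.measurable.comp hs
  have hν : ∫ x, g x ∂(ν ρ σ n) =
      (2 * Real.pi) ^ (-(n : ℝ) / 2) * ∫ y : E n, Real.exp (-‖y‖ ^ 2 / 2) * g (s ρ y) := by
    rw [ν_eq_map hρ hσ hcrit hn, integral_map hs.aemeasurable
      g.continuous.measurable.aestronglyMeasurable,
      integral_withDensity_eq_integral_toReal_smul
        (show Measurable fun y : E n => gaussianDensity n ‖y‖ from
          (measurable_gaussianDensity n).comp measurable_norm)
        (.of_forall fun y => ENNReal.ofReal_lt_top), ← integral_const_mul]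
    refine integral_congr_ae (.of_forall fun y => ?_)
    simp only [gaussianDensity, smul_eq_mul]
    rw [ENNReal.toReal_ofReal (by positivity), mul_assoc]
  rw [hν]
  have hc : Tendsto (fun N => (sphereConst n N).toReal) atTop
      (𝓝 ((2 * Real.pi) ^ (-(n : ℝ) / 2))) := by
    have := (ENNReal.tendsto_toReal ENNReal.ofReal_ne_top).comp (tendsto_sphereConst n)
    rwa [ENNReal.toReal_ofReal (by positivity)] at this
  refine (hc.mul (tendsto_integral_mul_sphereProfile n hgs (M := ‖g‖)
    fun y => g.norm_coe_le_norm _)).congr' ?_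
  filter_upwards [eventually_gt_atTop n] with N hN
  rw [pushforward_eq_map hρ hn hN, integral_map hs.aemeasurable
    g.continuous.measurable.aestronglyMeasurable, integral_withDensity_eq_integral_toReal_smul
      (show Measurable fun y : E n => sphereDensity n N ‖y‖ from
        (measurable_sphereDensity n N).comp measurable_norm)
      (.of_forall fun y => ENNReal.mul_lt_top (sphereConst_ne_zero_and_ne_top hn hN).2.lt_top
        ENNReal.ofReal_lt_top), ← integral_const_mul]
  refine integral_congr_ae (.of_forall fun y => ?_)
  simp only [sphereDensity, smul_eq_mul]
  rw [ENNReal.toReal_mul, ENNReal.toReal_ofReal (sphereProfile_nonneg n N (norm_nonneg y)),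
    mul_assoc]

end Densities

/-! ### Pointwise values and limits of the densities -/

section PointwiseDensity

variable {n N : ℕ} {ρ σ : ℝ → ℝ}

theorem norm_proj_le (hN : n < N) (x : E N) : ‖proj n N x‖ ≤ ‖x‖ := by
  obtain ⟨m, rfl⟩ := Nat.exists_eq_add_of_le hN.le
  rw [← splitIso_fst, ← (splitIso n m).norm_map x]
  exact WithLp.norm_fst_le _ _

theorem exists_proj_eq (hN : n < N) {y : E n} (hy : ‖y‖ ≤ √N) :
    ∃ z ∈ Metric.sphere (0 : E N) √N, proj n N z = y := by
  obtain ⟨m, rfl⟩ := Nat.exists_eq_add_of_le hN.le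
  have hm : 0 < m := by omega
  have hy2 : ‖y‖ ^ 2 ≤ ((n + m : ℕ) : ℝ) :=
    (Real.le_sqrt (norm_nonneg y) (by positivity)).1 hy
  -- A single extra coordinate supplies the length missing from y.
  let w : E m := EuclideanSpace.single ⟨0, hm⟩ √(((n + m : ℕ) : ℝ) - ‖y‖ ^ 2)
  have hw : ‖w‖ ^ 2 = ((n + m : ℕ) : ℝ) - ‖y‖ ^ 2 := by
    simp only [w, PiLp.norm_single]
    rw [Real.norm_of_nonneg (Real.sqrt_nonneg _), Real.sq_sqrt (by linarith)]
  refine ⟨(splitIso n m).symm (WithLp.toLp 2 (y, w)), ?_, ?_⟩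
  · rw [mem_sphere_zero_iff_norm, LinearIsometryEquiv.norm_map,
      ← Real.sqrt_sq (norm_nonneg (WithLp.toLp 2 (y, w))), WithLp.prod_norm_sq_eq_of_L2]
    congr 1
    change ‖y‖ ^ 2 + ‖w‖ ^ 2 = _
    rw [hw]
    ring
  · rw [← splitIso_fst, LinearIsometryEquiv.apply_symm_apply]
    rfl

theorem norm_mem_radii_of_mem_image (hρ : ConditionC ρ)
    (hσ : Function.LeftInverse σ (s ρ : ℝ → ℝ)) (hN : n < N) {x : E n} (hx : x ≠ 0)
    (h : x ∈ P ρ n N '' Metric.sphere 0 √(N : ℝ)) : ‖x‖ ∈ radii ρ ∧ σ ‖x‖ ≤ √N := by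
  obtain ⟨z, hz, rfl⟩ := h
  have hp : proj n N z ≠ 0 := fun h0 => hx (by rw [P, h0, s, if_pos rfl])
  refine ⟨hρ.mem_image_s_iff.1 ⟨proj n N z, hp, rfl⟩, ?_⟩
  rw [P, hρ.norm_s, hσ]
  exact (norm_proj_le hN z).trans_eq (mem_sphere_zero_iff_norm.1 hz)

theorem mem_image_of_inverse_le (hρ : ConditionC ρ)
    (hσ : Function.LeftInverse σ (s ρ : ℝ → ℝ)) (hN : n < N) {x : E n}
    (hx : ‖x‖ ∈ radii ρ) (hle : σ ‖x‖ ≤ √N) : x ∈ P ρ n N '' Metric.sphere 0 √(N : ℝ) := by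
  obtain ⟨y, -, rfl⟩ := hρ.mem_image_s_iff.2 hx
  rw [hρ.norm_s, hσ] at hle
  obtain ⟨z, hz, rfl⟩ := exists_proj_eq hN hle
  exact ⟨z, hz, rfl⟩

theorem continuousAt_sphereProfile (n : ℕ) {t : ℝ} (ht : 0 ≤ t) (h : t < √N) :
    ContinuousAt (sphereProfile n N) t ∧ 0 < sphereProfile n N t := by
  have hlt : t ^ 2 < N := (Real.lt_sqrt ht).1 h
  have hNpos : (0 : ℝ) < N := (sq_nonneg t).trans_lt hlt
  have hb : 0 < 1 - t ^ 2 / N := by rw [sub_pos, div_lt_one hNpos]; exact hlt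
  constructor
  · have hc : ContinuousAt (fun t : ℝ => (1 - t ^ 2 / N) ^ (((N : ℝ) - n - 2) / 2)) t :=
      ContinuousAt.rpow_const (by fun_prop) (.inl hb.ne')
    refine hc.congr ?_
    filter_upwards [Iio_mem_nhds h] with u hu
    rw [sphereProfile, indicator_of_mem hu]
  · rw [sphereProfile, indicator_of_mem (mem_Iio.2 h)]
    positivity

/-- Multiplication on [0, ∞] is discontinuous at 0 · ∞. Since σ' may be infinite, the other factors
must be nonzero, and since σ' is allowed any value in [0, ∞], they are also kept finite. -/
theorem continuousAt_radialDensity (hρ : ConditionC ρ)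
    (hσ : Function.LeftInverse σ (s ρ : ℝ → ℝ)) (d : ℕ) {h : ℝ → ℝ≥0∞} {t : ℝ}
    (ht : t ∈ radii ρ) (hc : ContinuousAt h (σ t)) (h0 : h (σ t) ≠ 0) (htop : h (σ t) ≠ ∞) :
    ContinuousAt (radialDensity ρ σ d h) t := by
  have hσc := hρ.continuousAt_inverse hσ ht
  have hσ0 := inverse_pos hσ ht
  have ht0 := hρ.pos_of_mem_radii ht
  have hratio : ContinuousAt (fun t => ENNReal.ofReal ((σ t / t) ^ d)) t :=
    ENNReal.continuous_ofReal.continuousAt.comp ((hσc.div continuousAt_id ht0.ne').pow d)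
  have hr0 : ENNReal.ofReal ((σ t / t) ^ d) ≠ 0 := by
    rw [ne_eq, ENNReal.ofReal_eq_zero, not_le]; positivity
  have h1 : ContinuousAt (fun t => h (σ t) * ENNReal.ofReal ((σ t / t) ^ d)) t :=
    ENNReal.Tendsto.mul (hc.comp hσc) (.inl h0) hratio (.inl hr0)
  have h2 : ContinuousAt
      (fun t => h (σ t) * ENNReal.ofReal ((σ t / t) ^ d) * extDeriv σ t) t :=
    ENNReal.Tendsto.mul h1 (.inl (mul_ne_zero h0 hr0)) (hρ.continuousAt_extDeriv_inverse hσ ht)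
      (.inr (ENNReal.mul_ne_top htop ENNReal.ofReal_ne_top))
  refine h2.congr ?_
  filter_upwards [hρ.isOpen_radii.mem_nhds ht] with u hu
  rw [radialDensity, indicator_of_mem hu]

/-- Where σ‖x‖ < √N the profile is positive and continuous, so ball averages converge to it; off the
image both sides vanish. The boundary σ‖x‖ = √N is excluded because the profile may be discontinuous
there. -/
theorem fN_eq_radialDensity (hρ : ConditionC ρ) (hσ : Function.LeftInverse σ (s ρ : ℝ → ℝ))
    (hcrit : volume {r : ℝ | 0 < r ∧ deriv (s ρ : ℝ → ℝ) r = 0} = 0) (hn : 1 ≤ n) (hN : n < N)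
    {x : E n} (hx : x ≠ 0) (hne : ‖x‖ ∈ radii ρ → σ ‖x‖ ≠ √N) :
    fN ρ n N x = radialDensity ρ σ (n - 1) (sphereDensity n N) ‖x‖ := by
  by_cases hmem : ‖x‖ ∈ radii ρ ∧ σ ‖x‖ ≤ √N
  · obtain ⟨hr, hle⟩ := hmem
    have hlt := hle.lt_of_ne (hne hr)
    have hσ0 := inverse_pos hσ hr
    obtain ⟨hC0, hCt⟩ := sphereConst_ne_zero_and_ne_top hn hN
    obtain ⟨hpc, hp0⟩ := continuousAt_sphereProfile n hσ0.le hlt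
    rw [fN, if_pos (mem_image_of_inverse_le hρ hσ hN hr hle),
      pushforward_eq_withDensity hρ hσ hcrit hn hN]
    refine Tendsto.limUnder_eq (tendsto_withDensity_ball_div volume
      (D := fun x : E n => radialDensity ρ σ (n - 1) (sphereDensity n N) ‖x‖) ?_
      (.of_forall fun ε => measure_ball_lt_top.ne))
    refine ContinuousAt.comp (f := fun x : E n => ‖x‖) ?_ continuous_norm.continuousAt
    refine continuousAt_radialDensity hρ hσ _ hr ?_ ?_ ?_
    · exact ENNReal.Tendsto.const_mul
        (ENNReal.continuous_ofReal.continuousAt.comp hpc) (.inr hCt)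
    · exact mul_ne_zero hC0 (by simpa using hp0)
    · exact ENNReal.mul_ne_top hCt ENNReal.ofReal_ne_top
  · rw [fN, if_neg fun h => hmem (norm_mem_radii_of_mem_image hρ hσ hN hx h), radialDensity]
    by_cases hr : ‖x‖ ∈ radii ρ
    · have hgt : √N < σ ‖x‖ := not_le.1 fun h => hmem ⟨hr, h⟩
      rw [indicator_of_mem hr, sphereDensity, sphereProfile,
        indicator_of_notMem (by simpa using hgt.le)]
      simp
    · rw [indicator_of_notMem hr]

theorem fN_ae_eq_radialDensity (hρ : ConditionC ρ) (hσ : Function.LeftInverse σ (s ρ : ℝ → ℝ))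
    (hcrit : volume {r : ℝ | 0 < r ∧ deriv (s ρ : ℝ → ℝ) r = 0} = 0) (hn : 1 ≤ n) (hN : n < N) :
    fN ρ n N =ᵐ[volume] fun x => radialDensity ρ σ (n - 1) (sphereDensity n N) ‖x‖ := by
  have : Nonempty (Fin n) := ⟨⟨0, hn⟩⟩
  filter_upwards [compl_mem_ae_iff.2 (measure_singleton (0 : E n)),
    compl_mem_ae_iff.2 (Measure.addHaar_sphere volume (0 : E n) (s ρ √(N : ℝ)))] with x hx hx'
  refine fN_eq_radialDensity hρ hσ hcrit hn hN hx fun hr h => hx' ?_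
  rw [mem_sphere_zero_iff_norm, ← h, s_inverse hσ hr]

theorem tendsto_fN (hρ : ConditionC ρ) (hσ : Function.LeftInverse σ (s ρ : ℝ → ℝ))
    (hcrit : volume {r : ℝ | 0 < r ∧ deriv (s ρ : ℝ → ℝ) r = 0} = 0) (hn : 1 ≤ n)
    {x : E n} (hx : x ≠ 0) :
    Tendsto (fun N : ℕ => fN ρ n N x) atTop (𝓝 (f ρ σ n x)) := by
  have hlarge : ∀ᶠ N : ℕ in atTop, σ ‖x‖ < √(N : ℝ) :=
    (Real.tendsto_sqrt_atTop.comp tendsto_natCast_atTop_atTop).eventually_gt_atTop _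
  have heq : ∀ᶠ N : ℕ in atTop,
      radialDensity ρ σ (n - 1) (sphereDensity n N) ‖x‖ = fN ρ n N x := by
    filter_upwards [hlarge, eventually_gt_atTop n] with N h hN
    exact (fN_eq_radialDensity hρ hσ hcrit hn hN hx fun _ => h.ne).symm
  refine Tendsto.congr' heq ?_
  rw [f_eq_radialDensity hρ σ]
  by_cases hr : ‖x‖ ∈ radii ρ
  swap
  · simp [radialDensity, hr]
  have hσ0 := inverse_pos hσ hr
  have hx0 := norm_pos_iff.2 hx
  have hr0 : ENNReal.ofReal ((σ ‖x‖ / ‖x‖) ^ (n - 1)) ≠ 0 := by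
    rw [ne_eq, ENNReal.ofReal_eq_zero, not_le]; positivity
  have hg0 : gaussianDensity n (σ ‖x‖) ≠ 0 := by
    rw [gaussianDensity, ne_eq, ENNReal.ofReal_eq_zero, not_le]; positivity
  simp only [radialDensity, indicator_of_mem hr]
  -- The constant factor σ'(‖x‖) may be ∞; multiplying by it preserves the limit because the
  -- Gaussian and ratio factors have a nonzero product.
  exact ENNReal.Tendsto.mul_const (ENNReal.Tendsto.mul_const (tendsto_sphereDensity n _)
    (.inr ENNReal.ofReal_ne_top)) (.inl (mul_ne_zero hg0 hr0))

end PointwiseDensity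

end PoincareLimit

end

theorem theorem1p1 (n : ℕ) (hn : 1 ≤ n) (ρ : ℝ → ℝ) (hρ : PoincareLimit.ConditionC ρ)
    (σ : ℝ → ℝ) (hσ : Function.LeftInverse σ (PoincareLimit.s ρ : ℝ → ℝ))
    (hcrit : volume {r : ℝ | 0 < r ∧ deriv (PoincareLimit.s ρ : ℝ → ℝ) r = 0} = 0) :
    -- `f_{n,N}^ρ` is the density of the push-forward measure
    (∀ N : ℕ, n < N → AEMeasurable (PoincareLimit.fN ρ n N) volume ∧
      PoincareLimit.pushforward ρ n N = volume.withDensity (PoincareLimit.fN ρ n N)) ∧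
    -- pointwise convergence of the densities away from the origin
    (∀ x : PoincareLimit.E n, x ≠ 0 →
      Tendsto (fun N : ℕ => PoincareLimit.fN ρ n N x) atTop (𝓝 (PoincareLimit.f ρ σ n x))) ∧
    -- the limit density has unit mass
    (Measurable (PoincareLimit.f ρ σ n) ∧ ∫⁻ x, PoincareLimit.f ρ σ n x = 1) ∧
    -- weak convergence of the push-forwards to the probability measure `ν_n^ρ`
    (IsProbabilityMeasure (PoincareLimit.ν ρ σ n) ∧
      (∀ N : ℕ, n < N → IsProbabilityMeasure (PoincareLimit.pushforward ρ n N)) ∧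
      ∀ g : PoincareLimit.E n →ᵇ ℝ,
        Tendsto (fun N : ℕ => ∫ x, g x ∂(PoincareLimit.pushforward ρ n N)) atTop
          (𝓝 (∫ x, g x ∂(PoincareLimit.ν ρ σ n)))) := by
  have hprob := PoincareLimit.isProbabilityMeasure_ν hρ hσ hcrit hn
  refine ⟨fun N hN => ?_, fun x hx => PoincareLimit.tendsto_fN hρ hσ hcrit hn hx, ⟨?_, ?_⟩,
    hprob, fun N hN => PoincareLimit.isProbabilityMeasure_pushforward hρ hN,
    PoincareLimit.tendsto_integral_pushforward hρ hσ hcrit hn⟩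
  · have hae := PoincareLimit.fN_ae_eq_radialDensity hρ hσ hcrit hn hN
    refine ⟨AEMeasurable.congr (Measurable.aemeasurable ?_) hae.symm, ?_⟩
    · exact (hρ.measurable_radialDensity hσ _
        (PoincareLimit.measurable_sphereDensity n N)).comp measurable_norm
    · rw [PoincareLimit.pushforward_eq_withDensity hρ hσ hcrit hn hN]
      exact withDensity_congr_ae hae.symm
  · rw [funext (PoincareLimit.f_eq_radialDensity hρ σ)]
    exact (hρ.measurable_radialDensity hσ _
      (PoincareLimit.measurable_gaussianDensity n)).comp measurable_norm
  · have h := hprob.measure_univ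
    rwa [PoincareLimit.ν, withDensity_apply _ .univ, Measure.restrict_univ] at h
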